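/- Let $L$ be a countable first-order language and let $T$ be a complete $L$-theory that is $\omega$-categorical, i.e. any two models of $T$ of cardinality $\aleph_0$ are isomorphic. Formulas are first-order $L$-formulas without parameters, and two formulas are $T$-equivalent if they are equivalent in every model of $T$. For $n\ge 0$, a formula is an $n$-formula of $T$ if it is $T$-equivalent to a Boolean combination of formulas each having at most $n$ free variables. The theory $T$ is $1$-ary if every formula is $T$-equivalent to a Boolean combination of formulas with at most one free variable and of formulas $x\approx y$; for $n\ge 2$, $T$ is $n$-ary if every formula is an $n$-formula of $T$. For $n\ge 1$, $T$ is almost $n$-ary if there are finitely many formulas $\varphi_1,\dots,\varphi_m$ ($m\ge 0$) such that every formula is $T$-equivalent to a Boolean combination of $n$-formulas of $T$ and of formulas obtained from $\varphi_1,\dots,\varphi_m$ by substituting variables (not necessarily distinct) for their free variables. Let $\mathrm{ar}(T)$ be the least $n\ge 1$ such that $T$ is $n$-ary, and $\mathrm{ar}(T)=\infty$ if there is no such $n$; let $\mathrm{aar}(T)$ be the least $n\ge 1$ such that $T$ is almost $n$-ary, and $\mathrm{aar}(T)=\infty$ if there is no such $n$. Then either $\mathrm{aar}(T)=1$ and $\mathrm{ar}(T)$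 is finite, or $\mathrm{aar}(T)=\mathrm{ar}(T)=\infty$. -/

import Mathlib

open FirstOrder Cardinal

universe u v w

namespace AlmostArity

open FirstOrder.Language

variable {L : FirstOrder.Language.{u, v}}

/-- Boolean combinations of members of a set `Δ` of first-order formulas. Formulas are written in the
countably many variables `x₀, x₁, …`, indexed by `ℕ`. -/
inductive BoolComb (Δ : Set (L.Formula ℕ)) : L.Formula ℕ → Prop
  | of {φ : L.Formula ℕ} : φ ∈ Δ → BoolComb Δ φ
  | bot : BoolComb Δ ⊥
  | top : BoolComb Δ ⊤
  | not {φ : L.Formula ℕ} : BoolComb Δ φ → BoolComb Δ φ.not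
  | and {φ ψ : L.Formula ℕ} : BoolComb Δ φ → BoolComb Δ ψ → BoolComb Δ (φ ⊓ ψ)
  | or {φ ψ : L.Formula ℕ} : BoolComb Δ φ → BoolComb Δ ψ → BoolComb Δ (φ ⊔ ψ)

/-- `φ` is equivalent, modulo the theory `T`, to a Boolean combination of formulas in `Δ`. -/
def ReducesTo (T : L.Theory) (Δ : Set (L.Formula ℕ)) (φ : L.Formula ℕ) : Prop :=
  ∃ ψ : L.Formula ℕ, BoolComb Δ ψ ∧ T.Iff φ ψ

/-- The formulas with (at most) `n` free variables. A formula with fewer than `n` free variables is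
one with `n` free variables after adding trivial conjuncts `x ≈ x`. -/
def formulasOfArity (L : FirstOrder.Language.{u, v}) (n : ℕ) : Set (L.Formula ℕ) :=
  {φ | (BoundedFormula.freeVarFinset φ).card ≤ n}

/-- The formulas `x ≈ y`, for variables `x` and `y`. -/
def equalities (L : FirstOrder.Language.{u, v}) : Set (L.Formula ℕ) :=
  {φ | ∃ i j : ℕ, φ = Term.equal (Term.var i) (Term.var j)}

/-- `φ` is an `n`-ary formula of `T` (an `n`-formula): it is `T`-equivalent to a Boolean
combination of formulas with `n` free variables. -/
def IsNFormula (T : L.Theory) (n : ℕ) (φ : L.Formula ℕ) : Prop :=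
  ReducesTo T (formulasOfArity L n) φ

/-- `T` is unary: every formula is `T`-equivalent to a Boolean combination of formulas with one free
variable and of equalities of variables. -/
def IsUnary (T : L.Theory) : Prop :=
  ∀ φ : L.Formula ℕ, ReducesTo T (formulasOfArity L 1 ∪ equalities L) φ

/-- `T` is `n`-ary (meaningful for `n ≥ 1`): unary when `n = 1`, and for `n ≥ 2` every formula is an
`n`-formula. -/
def IsNAry (T : L.Theory) (n : ℕ) : Prop :=
  if n = 1 then IsUnary T else ∀ φ : L.Formula ℕ, IsNFormula T n φ

/-- The formulas obtained from members of `W` by substituting variables for the free variables; the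
substitution may identify variables. -/
def substitutions (W : Set (L.Formula ℕ)) : Set (L.Formula ℕ) :=
  {χ | ∃ φ ∈ W, ∃ σ : ℕ → ℕ, χ = φ.relabel σ}

/-- `T` is almost `n`-ary: there is a finite set `W` of formulas such that every formula is
`T`-equivalent to a Boolean combination of `n`-formulas and of formulas obtained from members of `W`
by substitution of free variables. -/
def IsAlmostNAry (T : L.Theory) (n : ℕ) : Prop :=
  ∃ W : Finset (L.Formula ℕ), ∀ φ : L.Formula ℕ,
    ReducesTo T ({χ | IsNFormula T n χ} ∪ substitutions (W : Set (L.Formula ℕ))) φ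

/-- `ar(T)`: the least `n ≥ 1` such that `T` is `n`-ary, and `∞` if there is none. (An `n`-ary theory
is `k`-ary for all `k ≥ n`, see `IsNAry.mono`, so this is the unique `n` such that `T` is `n`-ary and
not `(n-1)`-ary.) -/
noncomputable def ar (T : L.Theory) : ℕ∞ :=
  sInf {N : ℕ∞ | ∃ n : ℕ, N = n ∧ 1 ≤ n ∧ IsNAry T n}

/-- `aar(T)`: the least `n ≥ 1` such that `T` is almost `n`-ary, and `∞` if there is none. -/
noncomputable def aar (T : L.Theory) : ℕ∞ :=
  sInf {N : ℕ∞ | ∃ n : ℕ, N = n ∧ 1 ≤ n ∧ IsAlmostNAry T n}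

theorem BoolComb.mono {Δ Γ : Set (L.Formula ℕ)} (h : Δ ⊆ Γ) {φ : L.Formula ℕ}
    (hφ : BoolComb Δ φ) : BoolComb Γ φ := by
  induction hφ with
  | of h' => exact .of (h h')
  | bot => exact .bot
  | top => exact .top
  | not _ ih => exact .not ih
  | and _ _ ih₁ ih₂ => exact .and ih₁ ih₂
  | or _ _ ih₁ ih₂ => exact .or ih₁ ih₂

theorem equalities_subset {n : ℕ} (hn : 2 ≤ n) : equalities L ⊆ formulasOfArity L n := by
  rintro φ ⟨i, j, rfl⟩
  refine le_trans ?_ hn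
  simp only [Term.equal, Term.bdEqual, BoundedFormula.freeVarFinset, Term.relabel]
  refine (Finset.card_union_le _ _).trans ?_
  simp [Term.varFinsetLeft]

/-- Arities are monotone. -/
theorem IsNAry.mono {T : L.Theory} {n k : ℕ} (hn : 1 ≤ n) (hnk : n ≤ k) (h : IsNAry T n) :
    IsNAry T k := by
  rcases hnk.eq_or_lt with rfl | hlt
  · exact h
  have hk : k ≠ 1 := by omega
  have hmono : formulasOfArity L n ⊆ formulasOfArity L k := fun φ hφ => le_trans hφ hnk
  simp only [IsNAry, hk, if_false]
  intro φ
  by_cases h1 : n = 1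
  · subst h1
    obtain ⟨ψ, hψ, e⟩ := (show IsUnary T by simpa [IsNAry] using h) φ
    exact ⟨ψ, hψ.mono (Set.union_subset hmono (equalities_subset hlt)), e⟩
  · simp only [IsNAry, h1, if_false] at h
    obtain ⟨ψ, hψ, e⟩ := h φ
    exact ⟨ψ, hψ.mono hmono, e⟩

end AlmostArity

/-!
If `T` is almost `n`-ary, then `T` is `m`-ary as soon as `m ≥ 2` bounds `n` and the number of free
variables of each of the finitely many extra formulas, since substitution does not increase that
number. Conversely, suppose that `T` has finitely many complete types in `m` variables. A formula
is determined up to equivalence by the set of types containing it, so there are finitely many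
formulas in `m` variables up to equivalence. If every formula is an `m`-formula, representatives of
these can serve as the extra formulas, and `T` is almost `1`-ary.

That the type spaces are finite is the Ryll-Nardzewski theorem, proved here by Baire category. A
type in the variables `x₀, x₁, …` which satisfies enough Henkin axioms is the type of an enumeration
of an elementary substructure, and such types are residual. Restriction of types to finitely many
variables is continuous and open, so the preimages of a meagre set under the countably many
restrictions are meagre; hence some countable model omits every type of the given meagre set. A
non-isolated type is meagre by itself, yet it is realized in every countable model: by categoricity
if the model is infinite, and because realized types are dense if the model is finite. Thus
all types are isolated, and the type space, being compact, is finite.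
-/

namespace AlmostArity

open FirstOrder.Language
open Function Set TopologicalSpace
open FirstOrder.Language.Theory FirstOrder.Language.Formula

universe w₁ w₂

variable {L : FirstOrder.Language.{u, v}} {T : L.Theory}

section Types

variable {α : Type w₁} {β : Type w₂}

section Realizations

variable {M N : Type*} [L.Structure M] [L.Structure N]

theorem realize_congr_of_eqOn_freeVarFinset [DecidableEq α] {φ : L.Formula α} {x y : α → M}
    (h : EqOn x y φ.freeVarFinset) : φ.Realize x ↔ φ.Realize y :=
  (BoundedFormula.realize_restrictFreeVar (f := id) (v := fun a ↦ x a) x fun _ ↦ rfl).symm.trans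
    (BoundedFormula.realize_restrictFreeVar (f := id) y fun a ↦ h a.2)

variable [Nonempty M] [M ⊨ T] [Nonempty N] [N ⊨ T]

theorem typeOf_mem_typesWith {φ : L.Formula α} {x : α → M} :
    T.typeOf x ∈ T.typesWith (equivSentence φ) ↔ φ.Realize x :=
  CompleteType.formula_mem_typeOf

theorem typeOf_eq_typeOf_iff {x : α → M} {y : α → N} :
    T.typeOf x = T.typeOf y ↔ ∀ φ : L.Formula α, φ.Realize x ↔ φ.Realize y := by
  simp only [SetLike.ext_iff, CompleteType.mem_typeOf, equivSentence.surjective.forall,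
    Equiv.symm_apply_apply]

theorem typeOf_elementaryEmbedding_comp (f : M ↪ₑ[L] N) (x : α → M) :
    T.typeOf (f ∘ x) = T.typeOf x :=
  typeOf_eq_typeOf_iff.2 fun φ ↦ f.map_formula φ x

theorem realizedTypes_subset_of_elementaryEmbedding (f : M ↪ₑ[L] N) :
    T.realizedTypes M α ⊆ T.realizedTypes N α := by
  rintro _ ⟨x, rfl⟩
  exact ⟨f ∘ x, typeOf_elementaryEmbedding_comp f x⟩

end Realizations

theorem isTopologicalBasis_range_typesWith_equivSentence :
    IsTopologicalBasis (range fun φ : L.Formula α ↦ T.typesWith (equivSentence φ)) := by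
  rw [← Function.comp_def T.typesWith, equivSentence.surjective.range_comp T.typesWith]
  exact _root_.CompleteType.isTopologicalBasis_range_typesWith

open Classical in
/-- The formula `∃ x, θ(x) ∧ x ∘ σ = y` in the variables `y`. Only the coordinates of `x` at the
free variables of `θ` and in the range of `σ` are quantified over, so that `β` may be infinite. -/
noncomputable def projection [Finite α] (σ : α → β) (θ : L.Formula β) : L.Formula α :=
  letI s : Set β := θ.freeVarFinset ∪ range σ
  letI θ' : L.Formula s := θ.restrictFreeVar fun b ↦ ⟨b, .inl b.2⟩
  iExs s (θ'.relabel Sum.inr ⊓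
    iInf fun a ↦ (Term.var (.inr ⟨σ a, .inr ⟨a, rfl⟩⟩)).equal (Term.var (.inl a)))

theorem realize_projection [Finite α] {M : Type*} [L.Structure M] [Nonempty M] {σ : α → β}
    {θ : L.Formula β} {y : α → M} :
    (projection σ θ).Realize y ↔ ∃ x : β → M, θ.Realize x ∧ x ∘ σ = y := by
  classical
  simp only [projection, realize_iExs, realize_inf, realize_relabel, Sum.elim_comp_inr,
    realize_iInf, realize_equal, Term.realize_var, Sum.elim_inl, Sum.elim_inr]
  rw [(Subtype.val_injective.surjective_comp_right (γ := M)).exists]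
  simp only [Formula.Realize, funext_iff, Function.comp_apply]
  exact exists_congr fun x ↦ and_congr_left' <|
    BoundedFormula.realize_restrictFreeVar x fun _ ↦ rfl

/-- The restriction of a complete type `p` along a map `σ` of variables, i.e. the type of `x ∘ σ`
for a realization `x` of `p`; it does not depend on the realization, see `comap_typeOf`. -/
noncomputable def comap (σ : α → β) (p : T.CompleteType β) : T.CompleteType α :=
  T.typeOf ((T.exists_modelType_is_realized_in p).choose_spec.choose ∘ σ)

theorem comap_typeOf {M : Type*} [L.Structure M] [Nonempty M] [M ⊨ T] (σ : α → β) (x : β → M) :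
    comap σ (T.typeOf x) = T.typeOf (x ∘ σ) := by
  have hx := (T.exists_modelType_is_realized_in (T.typeOf x)).choose_spec.choose_spec
  refine typeOf_eq_typeOf_iff.2 fun φ ↦ ?_
  simpa only [realize_relabel] using typeOf_eq_typeOf_iff.1 hx (φ.relabel σ)

theorem comap_mem_typesWith_iff {σ : α → β} {p : T.CompleteType β} {φ : L.Formula α} :
    comap σ p ∈ T.typesWith (equivSentence φ) ↔ p ∈ T.typesWith (equivSentence (φ.relabel σ)) := by
  obtain ⟨M, x, rfl⟩ := T.exists_modelType_is_realized_in p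
  rw [comap_typeOf, typeOf_mem_typesWith, typeOf_mem_typesWith, realize_relabel]

theorem continuous_comap (σ : α → β) :
    Continuous (comap σ : T.CompleteType β → T.CompleteType α) := by
  refine isTopologicalBasis_range_typesWith_equivSentence.continuous_iff.2 ?_
  rintro _ ⟨φ, rfl⟩
  convert _root_.CompleteType.isOpen_typesWith (T := T) (equivSentence (φ.relabel σ)) using 1
  ext p
  exact comap_mem_typesWith_iff

theorem image_comap_typesWith [Finite α] (σ : α → β) (θ : L.Formula β) :
    comap σ '' T.typesWith (equivSentence θ) = T.typesWith (equivSentence (projection σ θ)) := by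
  refine Subset.antisymm ?_ fun q hq ↦ ?_
  · rintro _ ⟨p, hp, rfl⟩
    obtain ⟨M, x, rfl⟩ := T.exists_modelType_is_realized_in p
    rw [comap_typeOf, typeOf_mem_typesWith]
    exact realize_projection.2 ⟨x, typeOf_mem_typesWith.1 hp, rfl⟩
  · obtain ⟨M, y, rfl⟩ := T.exists_modelType_is_realized_in q
    obtain ⟨x, hx, rfl⟩ := realize_projection.1 (typeOf_mem_typesWith.1 hq)
    exact ⟨T.typeOf x, typeOf_mem_typesWith.2 hx, comap_typeOf σ x⟩

theorem isOpenMap_comap [Finite α] (σ : α → β) :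
    IsOpenMap (comap σ : T.CompleteType β → T.CompleteType α) := by
  refine isTopologicalBasis_range_typesWith_equivSentence.isOpenMap_iff.2 ?_
  rintro _ ⟨θ, rfl⟩
  rw [image_comap_typesWith]
  exact _root_.CompleteType.isOpen_typesWith _

end Types

section Witnesses

variable {α : Type w₁}

/-- The Henkin axiom `(∃ a, φ(x, a)) → φ(x, xⱼ)` in the variables `x`. The language and the set of
variables are kept fixed: a variable `j` plays the role of the Henkin constant. -/
noncomputable def witness (φ : L.Formula (α ⊕ Fin 1)) (j : α) : L.Formula α :=
  (φ.iExs (Fin 1)).imp (φ.relabel (Sum.elim id fun _ ↦ j))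

theorem realize_witness {M : Type*} [L.Structure M] {φ : L.Formula (α ⊕ Fin 1)} {j : α}
    {x : α → M} : (witness φ j).Realize x ↔
      ((∃ a, φ.Realize (Sum.elim x fun _ ↦ a)) → φ.Realize (Sum.elim x fun _ ↦ x j)) := by
  rw [witness, realize_imp, realize_iExs, realize_relabel, Sum.comp_elim,
    (Equiv.funUnique (Fin 1) M).symm.surjective.exists]
  rfl

theorem exists_realize_witness [Infinite α] {M : Type*} [L.Structure M] {θ : L.Formula α}
    {x : α → M} (hx : θ.Realize x) (φ : L.Formula (α ⊕ Fin 1)) :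
    ∃ (y : α → M) (j : α), θ.Realize y ∧ (witness φ j).Realize y := by
  classical
  obtain ⟨j, hj⟩ := Infinite.exists_notMem_finset (θ.freeVarFinset ∪ φ.freeVarFinset.toLeft)
  simp only [Finset.mem_union, Finset.mem_toLeft, not_or] at hj
  by_cases! hφ : ∃ a, φ.Realize (Sum.elim x fun _ ↦ a)
  · obtain ⟨a, ha⟩ := hφ
    have hne : ∀ {k}, k ≠ j → update x j a k = x k := fun hk ↦ update_of_ne hk a x
    refine ⟨update x j a, j, ?_, realize_witness.2 fun _ ↦ ?_⟩
    · refine (realize_congr_of_eqOn_freeVarFinset fun k hk ↦ hne ?_).2 hx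
      rintro rfl
      exact hj.1 hk
    · refine (realize_congr_of_eqOn_freeVarFinset ?_).2 ha
      rintro (k | i) hk
      · refine hne ?_
        rintro rfl
        exact hj.2 hk
      · simp
  · exact ⟨x, j, hx, realize_witness.2 fun ⟨a, ha⟩ ↦ (hφ a ha).elim⟩

theorem eventually_residual_witness [Infinite α] [Countable α] [Countable L.Symbols] :
    ∀ᶠ p in residual (T.CompleteType α), ∀ φ : L.Formula (α ⊕ Fin 1),
      ∃ j, p ∈ T.typesWith (equivSentence (witness φ j)) := by
  refine eventually_countable_forall.2 fun φ ↦ ?_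
  simp only [← mem_iUnion]
  refine residual_of_dense_open
    (isOpen_iUnion fun j ↦ _root_.CompleteType.isOpen_typesWith _) ?_
  refine isTopologicalBasis_range_typesWith_equivSentence.dense_iff.2 ?_
  rintro _ ⟨θ, rfl⟩ ⟨p, hp⟩
  obtain ⟨M, x, rfl⟩ := T.exists_modelType_is_realized_in p
  obtain ⟨y, j, hy, hyj⟩ := exists_realize_witness (typeOf_mem_typesWith.1 hp) φ
  exact ⟨T.typeOf y, typeOf_mem_typesWith.2 hy, mem_iUnion.2 ⟨j, typeOf_mem_typesWith.2 hyj⟩⟩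

theorem meetsDefinable_range {M : Type*} [L.Structure M] {x : α → M}
    (hx : ∀ φ : L.Formula (α ⊕ Fin 1), ∃ j, (witness φ j).Realize x) :
    L.MeetsDefinable (range x) := by
  rintro D ⟨a, ha⟩ ⟨φ, hφ⟩
  let ψ : L.Formula (α ⊕ Fin 1) :=
    Formula.relabel (Sum.map (rangeSplitting x) id) (BoundedFormula.constantsVarsEquiv φ)
  have hψ : ∀ b, ψ.Realize (Sum.elim x fun _ ↦ b) ↔ b ∈ D := fun b ↦ by
    have hx' : x ∘ rangeSplitting x = fun c ↦ (L.con c : M) := funext (apply_rangeSplitting x)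
    rw [realize_relabel, Sum.elim_comp_map, hx']
    exact BoundedFormula.realize_constantsVarsEquiv.trans (Set.ext_iff.1 hφ fun _ ↦ b).symm
  obtain ⟨j, hj⟩ := hx ψ
  exact ⟨x j, (hψ _).1 (realize_witness.1 hj ⟨a, (hψ _).2 ha⟩), mem_range_self j⟩

end Witnesses

section RyllNardzewski

variable {α : Type w₁}

theorem exists_countable_model_disjoint_realizedTypes [Countable L.Symbols] [Finite α]
    (hT : T.IsSatisfiable) {S : Set (T.CompleteType α)} (hS : IsMeagre S) :
    ∃ M : ModelType.{u, v, max u v} T, Countable M ∧ Disjoint (T.realizedTypes M α) S := by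
  have : Nonempty (T.CompleteType ℕ) := CompleteType.nonempty_iff.2 hT
  have hS' : ∀ᶠ p in residual (T.CompleteType ℕ), ∀ σ : α → ℕ, comap σ p ∉ S :=
    eventually_countable_forall.2 fun σ ↦
      hS.preimage_of_isOpenMap (continuous_comap σ) (isOpenMap_comap σ)
  obtain ⟨p, hpwit, hpS⟩ :=
    (dense_of_mem_residual (eventually_residual_witness.and hS')).nonempty
  obtain ⟨M, x, rfl⟩ := T.exists_modelType_is_realized_in p
  have hx : L.MeetsDefinable (range x) :=
    meetsDefinable_range fun φ ↦ (hpwit φ).imp fun _ ↦ typeOf_mem_typesWith.1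
  let N := hx.toElementarySubstructure
  have hN : (N : Set M) = range x := hx.closure_eq_self
  refine ⟨ModelType.of T N, (hN ▸ countable_range x : (N : Set M).Countable), ?_⟩
  rw [disjoint_left]
  rintro _ ⟨y, rfl⟩
  have hy : ∀ a, (y a : N).1 ∈ range x := fun a ↦ hN.subset (y a).2
  choose σ hσ using hy
  have hxσ : x ∘ σ = N.subtype ∘ y := funext hσ
  have hyσ : comap σ (T.typeOf x) = T.typeOf y := by
    rw [comap_typeOf, hxσ]
    exact typeOf_elementaryEmbedding_comp N.subtype y
  exact hyσ ▸ hpS σ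

theorem dense_realizedTypes (hT : T.IsComplete) (M : Type*) [L.Structure M] [Nonempty M]
    [M ⊨ T] : Dense (T.realizedTypes M α) := by
  refine isTopologicalBasis_range_typesWith_equivSentence.dense_iff.2 ?_
  rintro _ ⟨φ, rfl⟩ ⟨p, hp⟩
  obtain ⟨N, y, rfl⟩ := T.exists_modelType_is_realized_in p
  let ψ : L.Sentence := projection Empty.elim φ
  have hN : N ⊨ ψ := realize_projection.2 ⟨y, typeOf_mem_typesWith.1 hp, Subsingleton.elim _ _⟩
  have hM : M ⊨ ψ := ((hT.models_elementarily_equivalent M N).realize_sentence ψ).2 hN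
  obtain ⟨x, hx, -⟩ := realize_projection.1 hM
  exact ⟨T.typeOf x, typeOf_mem_typesWith.2 hx, x, rfl⟩

theorem realizedTypes_eq_univ_of_finite (hT : T.IsComplete) [Finite α] (M : Type*)
    [L.Structure M] [Nonempty M] [M ⊨ T] [Finite M] : T.realizedTypes M α = Set.univ :=
  (finite_range _).isClosed.closure_eq.symm.trans (dense_realizedTypes hT M).closure_eq

theorem exists_model_card_eq_aleph0_mem_realizedTypes [Countable L.Symbols] [Countable α]
    (M : ModelType.{u, v, w₂} T) [Infinite M] {p : T.CompleteType α}
    (hp : p ∈ T.realizedTypes M α) :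
    ∃ N : ModelType.{u, v, w₂} T, #N = ℵ₀ ∧ p ∈ T.realizedTypes N α := by
  obtain ⟨x, rfl⟩ := hp
  obtain ⟨S, hxS, hS⟩ := exists_elementarySubstructure_card_eq L (range x) aleph0.{w₂} le_rfl
    (by simpa using (countable_range x).le_aleph0)
    (by simpa only [lift_le_aleph0, lift_aleph0, Language.card] using mk_le_aleph0) (by simp)
  let y : α → S := fun a ↦ ⟨x a, hxS (mem_range_self a)⟩
  exact ⟨ModelType.of T S, by simpa using hS, y, (typeOf_elementaryEmbedding_comp S.subtype y).symm⟩

theorem nonempty_equiv_of_categorical (hcat : Categorical.{u, v, w} ℵ₀ T)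
    (M : ModelType.{u, v, w₁} T) (N : ModelType.{u, v, w₂} T) (hM : #M = ℵ₀) (hN : #N = ℵ₀) :
    Nonempty (M ≃[L] N) := by
  have : Denumerable M := (denumerable_iff.2 hM).some
  have : Denumerable N := (denumerable_iff.2 hN).some
  let eM : M ≃ ULift.{w} ℕ := (Denumerable.eqv M).trans Equiv.ulift.symm
  let eN : N ≃ ULift.{w} ℕ := (Denumerable.eqv N).trans Equiv.ulift.symm
  have hcard : #(ULift.{w} ℕ) = ℵ₀ := mk_eq_aleph0 _
  obtain ⟨e⟩ := hcat (M.equivInduced eM) (N.equivInduced eN) hcard hcard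
  let fM : M ≃[L] M.equivInduced eM := eM.inducedStructureEquiv
  let fN : N ≃[L] N.equivInduced eN := eN.inducedStructureEquiv
  exact ⟨(fN.symm.comp e).comp fM⟩

theorem isOpen_singleton_of_categorical [Countable L.Symbols] [Finite α] (hT : T.IsComplete)
    (hcat : Categorical.{u, v, w} ℵ₀ T) (p : T.CompleteType α) : IsOpen {p} := by
  by_contra hp
  have hmeagre : IsMeagre {p} := by
    refine (isClosed_singleton.isNowhereDense_iff.2 ?_).isMeagre
    exact interior_eq_empty_iff_dense_compl.2 (dense_compl_singleton_iff_not_open.2 hp)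
  obtain ⟨N, _, hN⟩ := exists_countable_model_disjoint_realizedTypes hT.1 hmeagre
  rw [disjoint_singleton_right] at hN
  cases finite_or_infinite N
  · have huniv : T.realizedTypes N α = Set.univ := realizedTypes_eq_univ_of_finite hT N
    exact hN (huniv ▸ mem_univ p)
  · obtain ⟨M, x, hx⟩ := T.exists_modelType_is_realized_in p
    have : Infinite M := (hT.models_elementarily_equivalent N M).infinite
    obtain ⟨K, hK, hpK⟩ := exists_model_card_eq_aleph0_mem_realizedTypes M ⟨x, hx⟩
    obtain ⟨e⟩ := nonempty_equiv_of_categorical hcat K N hK (mk_eq_aleph0 N)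
    exact hN (realizedTypes_subset_of_elementaryEmbedding e.toElementaryEmbedding hpK)

theorem finite_completeType_of_categorical [Countable L.Symbols] [Finite α] (hT : T.IsComplete)
    (hcat : Categorical.{u, v, w} ℵ₀ T) : Finite (T.CompleteType α) :=
  have := discreteTopology_iff_isOpen_singleton.2 (isOpen_singleton_of_categorical (α := α) hT hcat)
  finite_of_compact_of_discrete

end RyllNardzewski

section FreeVariables

variable {α β : Type*} [DecidableEq α] [DecidableEq β]

theorem coe_varFinsetLeft_restrictVarLeft_subset {γ : Type*} (t : L.Term (α ⊕ γ))
    (f : t.varFinsetLeft → β) : ((t.restrictVarLeft f).varFinsetLeft : Set β) ⊆ range f := by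
  induction t with
  | var a =>
    cases a with
    | inl a =>
      simpa only [Term.restrictVarLeft, Term.varFinsetLeft, Finset.coe_singleton,
        singleton_subset_iff] using mem_range_self _
    | inr c => simp [Term.restrictVarLeft, Term.varFinsetLeft]
  | func F ts ih =>
    simp only [Term.restrictVarLeft, Term.varFinsetLeft, Finset.coe_biUnion, iUnion_subset_iff]
    exact fun i _ ↦ (ih i _).trans (range_comp_subset_range _ f)

theorem coe_freeVarFinset_restrictFreeVar_subset {n : ℕ} (φ : L.BoundedFormula α n)
    (f : φ.freeVarFinset → β) : ((φ.restrictFreeVar f).freeVarFinset : Set β) ⊆ range f := by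
  induction φ with
  | falsum => simp [BoundedFormula.restrictFreeVar, BoundedFormula.freeVarFinset]
  | equal t₁ t₂ =>
    simp only [BoundedFormula.restrictFreeVar, BoundedFormula.freeVarFinset, Finset.coe_union]
    exact union_subset
      ((coe_varFinsetLeft_restrictVarLeft_subset t₁ _).trans (range_comp_subset_range _ f))
      ((coe_varFinsetLeft_restrictVarLeft_subset t₂ _).trans (range_comp_subset_range _ f))
  | rel R ts =>
    simp only [BoundedFormula.restrictFreeVar, BoundedFormula.freeVarFinset, Finset.coe_biUnion,
      iUnion_subset_iff]
    exact fun i _ ↦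
      (coe_varFinsetLeft_restrictVarLeft_subset (ts i) _).trans (range_comp_subset_range _ f)
  | imp φ₁ φ₂ ih₁ ih₂ =>
    simp only [BoundedFormula.restrictFreeVar, BoundedFormula.freeVarFinset, Finset.coe_union]
    exact union_subset ((ih₁ _).trans (range_comp_subset_range _ f))
      ((ih₂ _).trans (range_comp_subset_range _ f))
  | all φ ih => exact ih f

theorem card_freeVarFinset_restrictFreeVar_le {n : ℕ} (φ : L.BoundedFormula α n)
    (f : φ.freeVarFinset → β) :
    (φ.restrictFreeVar f).freeVarFinset.card ≤ φ.freeVarFinset.card := by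
  have hsub : (φ.restrictFreeVar f).freeVarFinset ⊆ Finset.univ.image f := by
    simpa only [← Finset.coe_subset, Finset.coe_image, Finset.coe_univ, image_univ] using
      coe_freeVarFinset_restrictFreeVar_subset φ f
  exact (Finset.card_le_card hsub).trans (Finset.card_image_le.trans (by simp))

end FreeVariables

section Equivalence

variable {α : Type w₁}

theorem iff_of_forall_realize {φ ψ : L.Formula α}
    (h : ∀ (M : ModelType.{u, v, max u v w₁} T) (x : α → M), φ.Realize x ↔ ψ.Realize x) :
    T.Iff φ ψ :=
  models_formula_iff.2 fun M x ↦ BoundedFormula.realize_iff.2 (h M x)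

theorem exists_finset_forall_exists_iff [Finite (T.CompleteType α)] :
    ∃ A : Finset (L.Formula α), ∀ φ, ∃ ψ ∈ A, T.Iff φ ψ := by
  let types (φ : L.Formula α) : Set (T.CompleteType α) := T.typesWith (equivSentence φ)
  refine ⟨(finite_range (rangeSplitting types)).toFinset, fun φ ↦ ?_⟩
  let ψ := rangeSplitting types ⟨types φ, mem_range_self φ⟩
  have hψ : types ψ = types φ := apply_rangeSplitting types _
  refine ⟨ψ, by simp [ψ], iff_of_forall_realize fun M x ↦ ?_⟩
  rw [← typeOf_mem_typesWith (T := T), ← typeOf_mem_typesWith (T := T)]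
  exact (Set.ext_iff.1 hψ _).symm

theorem exists_iff_relabel_of_mem_formulasOfArity {m : ℕ} {φ : L.Formula ℕ}
    (hφ : φ ∈ formulasOfArity L m) :
    ∃ (χ : L.Formula (Fin m)) (τ : Fin m → ℕ), T.Iff φ (χ.relabel τ) := by
  obtain ⟨f⟩ : Nonempty (BoundedFormula.freeVarFinset φ ↪ Fin m) := by
    rw [Embedding.nonempty_iff_card_le]
    simpa using show (BoundedFormula.freeVarFinset φ).card ≤ m from hφ
  let τ : Fin m → ℕ := extend f Subtype.val 0
  have hτ : ∀ a, τ (f a) = a := f.injective.extend_apply Subtype.val 0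
  refine ⟨φ.restrictFreeVar f, τ, iff_of_forall_realize fun M x ↦ ?_⟩
  rw [realize_relabel]
  exact (BoundedFormula.realize_restrictFreeVar (f := f) x fun a ↦ congrArg x (hτ a)).symm

end Equivalence

section Arity

variable {Δ Γ : Set (L.Formula ℕ)} {φ ψ : L.Formula ℕ} {m n : ℕ}

theorem ReducesTo.of_mem_of_iff (hψ : ψ ∈ Δ) (h : T.Iff φ ψ) : ReducesTo T Δ φ :=
  ⟨ψ, .of hψ, h⟩

theorem ReducesTo.trans (hφ : ReducesTo T Δ φ) (hΔ : ∀ ψ ∈ Δ, ReducesTo T Γ ψ) :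
    ReducesTo T Γ φ := by
  obtain ⟨ψ, hψ, hφψ⟩ := hφ
  suffices ReducesTo T Γ ψ from this.imp fun _ h ↦ ⟨h.1, hφψ.trans h.2⟩
  clear hφψ
  induction hψ with
  | of hψ => exact hΔ _ hψ
  | bot => exact ⟨⊥, .bot, .refl _⟩
  | top => exact ⟨⊤, .top, .refl _⟩
  | not _ ih =>
    obtain ⟨χ, hχ, h⟩ := ih
    exact ⟨χ.not, hχ.not, h.not⟩
  | and _ _ ih₁ ih₂ =>
    obtain ⟨χ₁, hχ₁, h₁⟩ := ih₁
    obtain ⟨χ₂, hχ₂, h₂⟩ := ih₂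
    refine ⟨χ₁ ⊓ χ₂, hχ₁.and hχ₂, iff_of_forall_realize fun M x ↦ ?_⟩
    rw [realize_inf, realize_inf, h₁.realize_iff, h₂.realize_iff]
  | or _ _ ih₁ ih₂ =>
    obtain ⟨χ₁, hχ₁, h₁⟩ := ih₁
    obtain ⟨χ₂, hχ₂, h₂⟩ := ih₂
    refine ⟨χ₁ ⊔ χ₂, hχ₁.or hχ₂, iff_of_forall_realize fun M x ↦ ?_⟩
    rw [realize_sup, realize_sup, h₁.realize_iff, h₂.realize_iff]

theorem IsNFormula.mono (hmn : m ≤ n) (hφ : IsNFormula T m φ) : IsNFormula T n φ := by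
  obtain ⟨ψ, hψ, h⟩ := hφ
  exact ⟨ψ, hψ.mono fun _ hχ ↦ le_trans hχ hmn, h⟩

theorem isNFormula_relabel (hφ : φ ∈ formulasOfArity L n) (σ : ℕ → ℕ) :
    IsNFormula T n (φ.relabel σ) := by
  let ψ : L.Formula ℕ := φ.restrictFreeVar fun a ↦ σ a
  have hψ : ψ ∈ formulasOfArity L n := (card_freeVarFinset_restrictFreeVar_le φ _).trans hφ
  refine .of_mem_of_iff hψ (iff_of_forall_realize fun M x ↦ ?_)
  rw [realize_relabel]
  exact (BoundedFormula.realize_restrictFreeVar (v := x) (x ∘ σ) fun _ ↦ rfl).symm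

theorem IsNAry.isNFormula_succ (hn : 1 ≤ n) (h : IsNAry T n) (φ : L.Formula ℕ) :
    IsNFormula T (n + 1) φ := by
  have hsucc := h.mono hn n.le_succ
  rw [IsNAry, if_neg (by omega)] at hsucc
  exact hsucc φ

theorem IsAlmostNAry.exists_isNAry (h : IsAlmostNAry T n) : ∃ m, 1 ≤ m ∧ IsNAry T m := by
  obtain ⟨W, hW⟩ := h
  let k := W.sup fun φ ↦ (BoundedFormula.freeVarFinset φ).card
  refine ⟨max n k + 2, by omega, ?_⟩
  rw [IsNAry, if_neg (by omega)]
  refine fun φ ↦ (hW φ).trans ?_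
  rintro _ (hψ | ⟨χ, hχ, σ, rfl⟩)
  · exact hψ.mono (by omega)
  · have hχk : (BoundedFormula.freeVarFinset χ).card ≤ k :=
      Finset.le_sup (f := fun φ : L.Formula ℕ ↦ (BoundedFormula.freeVarFinset φ).card) hχ
    exact (isNFormula_relabel hχk σ).mono (by omega)

theorem isAlmostNAry_of_forall_isNFormula [Finite (T.CompleteType (Fin m))]
    (h : ∀ φ, IsNFormula T m φ) (n : ℕ) : IsAlmostNAry T n := by
  classical
  obtain ⟨A, hA⟩ := exists_finset_forall_exists_iff (T := T) (α := Fin m)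
  refine ⟨A.image (relabel Fin.val), fun φ ↦ (h φ).trans fun ψ hψ ↦ ?_⟩
  obtain ⟨χ', τ, hψχ'⟩ := exists_iff_relabel_of_mem_formulasOfArity (T := T) hψ
  obtain ⟨χ, hχ, hχ'χ⟩ := hA χ'
  let σ : ℕ → ℕ := extend Fin.val τ 0
  have hσ : σ ∘ Fin.val = τ := extend_comp Fin.val_injective τ 0
  refine .of_mem_of_iff (ψ := (χ.relabel Fin.val).relabel σ)
    (.inr ⟨_, Finset.mem_coe.2 (Finset.mem_image_of_mem _ hχ), σ, rfl⟩) (hψχ'.trans ?_)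
  refine iff_of_forall_realize fun M x ↦ ?_
  simp only [realize_relabel, Function.comp_assoc, hσ]
  exact hχ'χ.realize_iff

theorem one_le_aar (T : L.Theory) : 1 ≤ aar T := by
  refine le_sInf ?_
  rintro _ ⟨n, rfl, hn, -⟩
  exact_mod_cast hn

theorem aar_eq_one (h : IsAlmostNAry T 1) : aar T = 1 :=
  le_antisymm (sInf_le ⟨1, Nat.cast_one.symm, le_rfl, h⟩) (one_le_aar T)

theorem ar_le (hn : 1 ≤ n) (h : IsNAry T n) : ar T ≤ n :=
  sInf_le ⟨n, rfl, hn, h⟩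

end Arity

theorem mainTheorem7_general (T : L.Theory) (hfin : ∀ n, Finite (T.CompleteType (Fin n))) :
    (aar T = 1 ∧ ∃ n : ℕ, ar T = n) ∨ (aar T = ⊤ ∧ ar T = ⊤) := by
  by_cases! h : ∃ m, 1 ≤ m ∧ IsNAry T m
  · obtain ⟨m, hm, hmT⟩ := h
    have := hfin (m + 1)
    have haar : IsAlmostNAry T 1 := isAlmostNAry_of_forall_isNFormula (hmT.isNFormula_succ hm) 1
    exact .inl ⟨aar_eq_one haar, (ENat.ne_top_iff_exists.1
      (ne_top_of_le_ne_top (ENat.natCast_ne_top m) (ar_le hm hmT))).imp fun _ ↦ Eq.symm⟩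
  · refine .inr ⟨sInf_eq_top.2 ?_, sInf_eq_top.2 ?_⟩
    · rintro _ ⟨n, -, -, hn⟩
      obtain ⟨m, hm, hmT⟩ := hn.exists_isNAry
      exact (h m hm hmT).elim
    · rintro _ ⟨n, -, hn, hnT⟩
      exact (h n hn hnT).elim

end AlmostArity

theorem mainTheorem7 {L : FirstOrder.Language.{u, v}} [Countable L.Symbols] (T : L.Theory)
    (hT : T.IsComplete) (hcat : Cardinal.Categorical.{u, v, w} ℵ₀ T) :
    (AlmostArity.aar T = 1 ∧ ∃ n : ℕ, AlmostArity.ar T = n) ∨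
      (AlmostArity.aar T = ⊤ ∧ AlmostArity.ar T = ⊤) :=
  AlmostArity.mainTheorem7_general T fun _ ↦
    AlmostArity.finite_completeType_of_categorical hT hcat
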